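/- Let $(X_i)_{i\in\mathbb Z}$ be a bi-infinite sequence of independent random variables with $P(X_i=0)=P(X_i=1)=p=\tfrac12$. For a real $\tau\ge 0$, call a block of consecutive samples $X_m,X_{m+1},\dots,X_{m+l-1}$ (with $m\in\mathbb Z$, $l\ge 1$) atypical if $$\Bigl|\frac1l\sum_{i=m}^{m+l-1}X_i-p\Bigr|>\sqrt{\frac{p(1-p)\ln 4}{l}}\,\sqrt{\tau+\tfrac32\log_2 l}\,,$$ and, for $n\in\mathbb Z$, let $P_A(X_n)$ be the probability that $X_n$ belongs to some atypical block, that is, that there are $m$ and $l$ with $m\le n<m+l$ such that the block of length $l$ starting at $m$ is atypical. Then there are absolute constants $K_1,K_2$ such that, for all $n\in\mathbb Z$ and all $\tau\ge 0$, $$P_A(X_n)\le\bigl(K_1\sqrt{\tau}+K_2\bigr)2^{-\tau}.$$ In particular, $P_A(X_n)<1$ for all sufficiently large $\tau$, and for every $\varepsilon>0$ we have $P_A(X_n)<\varepsilon$ for all sufficiently large $\tau$. -/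

import Mathlib

open MeasureTheory ProbabilityTheory

universe u

/-- A bi-infinite iid `{0,1}`-sequence on `(Ω, μ)` with `P(X i = 1) = p`. -/
structure IsBernoulliSequence {Ω : Type*} [MeasurableSpace Ω] (μ : Measure Ω) (p : ℝ)
    (X : ℤ → Ω → ℝ) : Prop where
  measurable : ∀ i, Measurable (X i)
  mem_bits : ∀ i ω, X i ω = 0 ∨ X i ω = 1
  prob_one : ∀ i, μ.real {ω | X i ω = 1} = p
  indep : iIndepFun X μ

/-- The fraction of ones in the block `x m, x (m + 1), …, x (m + l - 1)`. -/
noncomputable def blockMean (x : ℤ → ℝ) (m : ℤ) (l : ℕ) : ℝ :=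
  (∑ i ∈ Finset.range l, x (m + (i : ℤ))) / (l : ℝ)

/-- The threshold `√(p q ln 4 / l) * √(τ + (3/2) log₂ l)`, with `q = 1 - p`. -/
noncomputable def atypThreshold (p τ : ℝ) (l : ℕ) : ℝ :=
  Real.sqrt (p * (1 - p) * Real.log 4 / (l : ℝ)) *
    Real.sqrt (τ + (3 / 2) * Real.logb 2 (l : ℝ))

/-- The block of length `l` of `x` that starts at time `m` is classified as atypical. -/
def IsAtypicalBlock (p τ : ℝ) (x : ℤ → ℝ) (m : ℤ) (l : ℕ) : Prop :=
  atypThreshold p τ l < |blockMean x m l - p|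

/-- The sample `x n` is part of an atypical subsequence: some block of consecutive samples
that contains time `n`, of any start and any length, is atypical. -/
def InAtypicalSubsequence (p τ : ℝ) (x : ℤ → ℝ) (n : ℤ) : Prop :=
  ∃ (m : ℤ) (l : ℕ), m ≤ n ∧ n < m + (l : ℤ) ∧ IsAtypicalBlock p τ x m l

/-- The probability that the sample `X n` is part of an atypical subsequence. -/
noncomputable def atypSampleProb {Ω : Type*} [MeasurableSpace Ω] (μ : Measure Ω) (p τ : ℝ)
    (X : ℤ → Ω → ℝ) (n : ℤ) : ℝ :=
  μ.real {ω | InAtypicalSubsequence p τ (fun i => X i ω) n}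

/-! With `±1` steps, an atypical block of length `l` around `n` is a two-sided walk from `n` with
square above `l ln 4 (τ + 3/2 log₂ l)`. Hoeffding gives a single such block probability of order
`2^(-τ) l^(-3/2)`, but about `l` blocks of length `l` contain `n`, so a plain union bound diverges.

Instead, lengths are grouped by dyadic scale `2^k`, and the pairs of arm lengths are cut into square
cells of side about `2^k / (τ + k + 1)`. Lévy's inequality on each arm treats a whole cell like its
largest block (`measure_cell_le`). The side is small enough for the variation of length inside a
cell to cost only a constant factor, so scale `k` contributes `O((τ + k)² 2^(-τ - 3k/2))`.

A block of length at most `τ` is never atypical, so only scales with `2^(k + 1) ≥ τ` matter. There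
`τ² 2^(-3k/2)` sums to `O(√τ)`, and `k² 2^(-3k/2)` to `O(1)`. -/

/-! ### Maximal and tail inequalities for simple random walks, by counting -/

/-- The sign `1` of a set bit and `-1` of an unset bit. -/
def bitSign (b : Bool) : ℝ := if b then 1 else -1

/-- The position after `j` steps of the walk whose steps are the signs of the bits `v`. -/
def walkPos {M : ℕ} (v : Fin M → Bool) (j : ℕ) : ℝ :=
  ∑ i : Fin M, if (i : ℕ) < j then bitSign (v i) else 0

/-- The final position of the walk whose steps are the signs of the bits `v`. -/
def walkEnd {M : ℕ} (v : Fin M → Bool) : ℝ := ∑ i, bitSign (v i)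

lemma bitSign_not (b : Bool) : bitSign (!b) = -bitSign b := by
  cases b <;> simp [bitSign]

lemma walkPos_zero {M : ℕ} (v : Fin M → Bool) : walkPos v 0 = 0 := by simp [walkPos]

lemma walkPos_cons_succ {M : ℕ} (b : Bool) (v : Fin M → Bool) (j : ℕ) :
    walkPos (Fin.cons b v : Fin (M + 1) → Bool) (j + 1) = bitSign b + walkPos v j := by
  simp [walkPos, Fin.sum_univ_succ]

lemma walkEnd_cons {M : ℕ} (b : Bool) (v : Fin M → Bool) :
    walkEnd (Fin.cons b v : Fin (M + 1) → Bool) = bitSign b + walkEnd v := by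
  simp [walkEnd, Fin.sum_univ_succ]

lemma walkPos_not {M : ℕ} (v : Fin M → Bool) (j : ℕ) :
    walkPos (fun i => !(v i)) j = -walkPos v j := by
  simp only [walkPos, bitSign_not, ← Finset.sum_neg_distrib]
  exact Finset.sum_congr rfl fun i _ => by split_ifs <;> simp

lemma walkEnd_not {M : ℕ} (v : Fin M → Bool) :
    walkEnd (fun i => !(v i)) = -walkEnd v := by
  simp [walkEnd, bitSign_not]

lemma sum_bits_succ {M : ℕ} (f : (Fin (M + 1) → Bool) → ℝ) :
    ∑ v, f v = ∑ v : Fin M → Bool, f (Fin.cons true v) + ∑ v : Fin M → Bool, f (Fin.cons false v) := by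
  rw [← (Fin.consEquiv (fun _ : Fin (M + 1) => Bool)).sum_comp, Fintype.sum_prod_type]
  simp [Fin.consEquiv]

lemma sum_bits_not {ι : Type*} [Fintype ι] [DecidableEq ι] (f : (ι → Bool) → ℝ) :
    ∑ v : ι → Bool, f (fun i => !(v i)) = ∑ v, f v :=
  (Equiv.arrowCongr (Equiv.refl ι) Equiv.boolNot).sum_comp f

open Classical in
/-- At least half of all walks end at or above any `x ≤ 0`. -/
lemma pow_le_two_mul_sum_walkEnd {M : ℕ} {x : ℝ} (hx : x ≤ 0) :
    (2 : ℝ) ^ M ≤ 2 * ∑ v : Fin M → Bool, if x ≤ walkEnd v then 1 else 0 := by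
  -- Flipping all bits negates the end, so one of each flipped pair ends at or above `0 ≥ x`.
  have h := sum_bits_not (fun v : Fin M → Bool => if x ≤ walkEnd v then (1 : ℝ) else 0)
  have h2 : (2 : ℝ) ^ M = ∑ v : Fin M → Bool, 1 := by simp
  rw [two_mul]
  nth_rewrite 1 [← h]
  rw [h2, ← Finset.sum_add_distrib]
  refine Finset.sum_le_sum fun v _ => ?_
  rw [walkEnd_not]
  split_ifs <;> norm_num
  rename_i h1 h2
  linarith

open Classical in
/-- **Lévy's maximal inequality** for simple random walk, in counting form. -/
lemma sum_exists_walkPos_le {M : ℕ} (x : ℝ) :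
    (∑ v : Fin M → Bool, if ∃ j, x ≤ walkPos v j then (1 : ℝ) else 0) ≤
      2 * ∑ v : Fin M → Bool, if x ≤ walkEnd v then (1 : ℝ) else 0 := by
  rcases le_or_gt x 0 with hx | hx
  · refine le_trans ?_ (pow_le_two_mul_sum_walkEnd hx)
    have h2 : (2 : ℝ) ^ M = ∑ v : Fin M → Bool, 1 := by simp
    rw [h2]
    exact Finset.sum_le_sum fun v _ => by split_ifs <;> norm_num
  induction M generalizing x with
  | zero => simp [walkPos, hx.not_ge, walkEnd]
  | succ M ih =>
    -- The induction removes the first step, which shifts the level by `±1`. The new level may be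
    -- nonpositive, where the trivial bound replaces the induction hypothesis.
    have ih' : ∀ y : ℝ,
        (∑ v : Fin M → Bool, if ∃ j, y ≤ walkPos v j then (1 : ℝ) else 0) ≤
          2 * ∑ v : Fin M → Bool, if y ≤ walkEnd v then (1 : ℝ) else 0 := by
      intro y
      rcases le_or_gt y 0 with hy | hy
      · refine le_trans ?_ (pow_le_two_mul_sum_walkEnd hy)
        have h2 : (2 : ℝ) ^ M = ∑ v : Fin M → Bool, 1 := by simp
        rw [h2]
        exact Finset.sum_le_sum fun v _ => by split_ifs <;> norm_num
      · exact ih y hy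
    have key : ∀ (b : Bool) (v : Fin M → Bool),
        (∃ j, x ≤ walkPos (Fin.cons b v : Fin (M + 1) → Bool) j) ↔
          ∃ j, x - bitSign b ≤ walkPos v j := by
      intro b v
      constructor
      · rintro ⟨j, hj⟩
        cases j with
        | zero => rw [walkPos_zero] at hj; linarith
        | succ j => exact ⟨j, by rw [walkPos_cons_succ] at hj; linarith⟩
      · rintro ⟨j, hj⟩
        exact ⟨j + 1, by rw [walkPos_cons_succ]; linarith⟩
    have key2 : ∀ (b : Bool) (v : Fin M → Bool),
        (x ≤ walkEnd (Fin.cons b v : Fin (M + 1) → Bool)) ↔ x - bitSign b ≤ walkEnd v := by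
      intro b v
      rw [walkEnd_cons]
      constructor <;> intro h <;> linarith
    rw [sum_bits_succ, sum_bits_succ]
    simp only [key, key2]
    have h1 := ih' (x - bitSign true)
    have h2 := ih' (x - bitSign false)
    linarith

lemma sum_exp_walkEnd {M : ℕ} (t : ℝ) :
    ∑ v : Fin M → Bool, Real.exp (t * walkEnd v) = (2 * Real.cosh t) ^ M := by
  induction M with
  | zero => simp [walkEnd]
  | succ M ih =>
    rw [sum_bits_succ]
    simp only [walkEnd_cons, mul_add, Real.exp_add, ← Finset.mul_sum, ih]
    rw [pow_succ, Real.cosh_eq]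
    simp [bitSign]
    ring

open Classical in
/-- Hoeffding's inequality for two concatenated walks, in counting form. -/
lemma sum_walkEnd_add_le {M N : ℕ} (hMN : 0 < M + N) {x : ℝ} (hx : 0 ≤ x) :
    (∑ v : Fin M → Bool, ∑ w : Fin N → Bool,
        if x ≤ walkEnd v + walkEnd w then (1 : ℝ) else 0) ≤
      2 ^ (M + N) * Real.exp (-x ^ 2 / (2 * ((M : ℝ) + N))) := by
  have hK : (0 : ℝ) < (M : ℝ) + N := by exact_mod_cast hMN
  -- The minimiser of the Chernoff exponent `-t x + t² (M + N) / 2`.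
  set t : ℝ := x / ((M : ℝ) + N) with ht
  have ht0 : 0 ≤ t := by positivity
  calc (∑ v : Fin M → Bool, ∑ w : Fin N → Bool,
        if x ≤ walkEnd v + walkEnd w then (1 : ℝ) else 0)
      ≤ ∑ v : Fin M → Bool, ∑ w : Fin N → Bool,
          Real.exp (-(t * x)) * (Real.exp (t * walkEnd v) * Real.exp (t * walkEnd w)) := by
        refine Finset.sum_le_sum fun v _ => Finset.sum_le_sum fun w _ => ?_
        rw [← Real.exp_add, ← Real.exp_add]
        split_ifs with h
        · rw [Real.one_le_exp_iff]
          nlinarith [mul_le_mul_of_nonneg_left h ht0]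
        · positivity
    _ = Real.exp (-(t * x)) * (2 * Real.cosh t) ^ (M + N) := by
        simp only [← Finset.mul_sum, ← Finset.sum_mul, sum_exp_walkEnd, pow_add]
    _ ≤ Real.exp (-(t * x)) * (2 ^ (M + N) * Real.exp (t ^ 2 / 2) ^ (M + N)) := by
        rw [mul_pow]
        gcongr
        exact Real.cosh_le_exp_half_sq t
    _ = 2 ^ (M + N) * Real.exp (-x ^ 2 / (2 * ((M : ℝ) + N))) := by
        rw [← Real.exp_nat_mul, mul_left_comm, ← Real.exp_add]
        congr 2
        rw [ht]
        push_cast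
        field_simp
        ring

-- With one arm frozen, the other is a walk facing a shifted level. Lévy's inequality is applied to
-- each arm in turn, at a factor 2 each.
open Classical in
lemma sum_exists_walkPos_add_le {M N : ℕ} (hMN : 0 < M + N) {x : ℝ} (hx : 0 ≤ x) :
    (∑ v : Fin M → Bool, ∑ w : Fin N → Bool,
        if ∃ a b, x ≤ walkPos v a + walkPos w b then (1 : ℝ) else 0) ≤
      4 * (2 ^ (M + N) * Real.exp (-x ^ 2 / (2 * ((M : ℝ) + N)))) := by
  have h := sum_walkEnd_add_le (M := M) (N := N) hMN hx
  refine le_trans ?_ (mul_le_mul_of_nonneg_left h (by norm_num))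
  have step1 : ∀ v : Fin M → Bool,
      (∑ w : Fin N → Bool, if ∃ a b, x ≤ walkPos v a + walkPos w b then (1 : ℝ) else 0) ≤
      2 * ∑ w : Fin N → Bool, if ∃ a, x ≤ walkPos v a + walkEnd w then (1 : ℝ) else 0 := by
    intro v
    obtain ⟨a₀, -, ha₀⟩ : ∃ a₀ ∈ Finset.range (M + 1), ∀ a ∈ Finset.range (M + 1),
        walkPos v a ≤ walkPos v a₀ :=
      Finset.exists_max_image _ _ ⟨0, by simp⟩
    have hmax : ∀ a, walkPos v a ≤ walkPos v a₀ := by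
      intro a
      rcases le_or_gt a M with h | h
      · exact ha₀ a (by simp; omega)
      · have : walkPos v a = walkPos v M := by
          refine Finset.sum_congr rfl fun i _ => ?_
          have := i.2
          rw [if_pos (by omega), if_pos (by omega)]
        rw [this]
        exact ha₀ M (by simp)
    have e1 : ∀ w : Fin N → Bool, (∃ a b, x ≤ walkPos v a + walkPos w b) ↔
        ∃ b, x - walkPos v a₀ ≤ walkPos w b := by
      refine fun w => ⟨?_, ?_⟩
      · rintro ⟨a, b, hab⟩
        exact ⟨b, by linarith [hmax a]⟩
      · rintro ⟨b, hb⟩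
        exact ⟨a₀, b, by linarith⟩
    have e2 : ∀ w : Fin N → Bool, (∃ a, x ≤ walkPos v a + walkEnd w) ↔
        x - walkPos v a₀ ≤ walkEnd w := by
      refine fun w => ⟨?_, ?_⟩
      · rintro ⟨a, ha⟩
        linarith [hmax a]
      · intro hb
        exact ⟨a₀, by linarith⟩
    simp only [e1, e2]
    exact sum_exists_walkPos_le _
  have step2 : ∀ w : Fin N → Bool,
      (∑ v : Fin M → Bool, if ∃ a, x ≤ walkPos v a + walkEnd w then (1 : ℝ) else 0) ≤
      2 * ∑ v : Fin M → Bool, if x ≤ walkEnd v + walkEnd w then (1 : ℝ) else 0 := by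
    intro w
    simp only [← sub_le_iff_le_add]
    exact sum_exists_walkPos_le _
  calc _ ≤ ∑ v : Fin M → Bool, 2 * ∑ w : Fin N → Bool,
          if ∃ a, x ≤ walkPos v a + walkEnd w then (1 : ℝ) else 0 :=
        Finset.sum_le_sum fun v _ => step1 v
    _ = 2 * ∑ w : Fin N → Bool, ∑ v : Fin M → Bool,
          if ∃ a, x ≤ walkPos v a + walkEnd w then (1 : ℝ) else 0 := by
        rw [← Finset.mul_sum, Finset.sum_comm]
    _ ≤ 2 * ∑ w : Fin N → Bool, (2 * ∑ v : Fin M → Bool,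
          if x ≤ walkEnd v + walkEnd w then (1 : ℝ) else 0) := by
        gcongr with w
        exact step2 w
    _ = _ := by
        rw [← Finset.mul_sum, Finset.sum_comm]
        ring

open Classical in
lemma sum_exists_abs_walkPos_add_le {M N : ℕ} (hMN : 0 < M + N) {x : ℝ} (hx : 0 ≤ x) :
    (∑ v : Fin M → Bool, ∑ w : Fin N → Bool,
        if ∃ a b, x ≤ |walkPos v a + walkPos w b| then (1 : ℝ) else 0) ≤
      8 * (2 ^ (M + N) * Real.exp (-x ^ 2 / (2 * ((M : ℝ) + N)))) := by
  have h := sum_exists_walkPos_add_le (M := M) (N := N) hMN hx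
  have hflip : (∑ v : Fin M → Bool, ∑ w : Fin N → Bool,
        if ∃ a b, x ≤ -(walkPos v a + walkPos w b) then (1 : ℝ) else 0) =
      ∑ v : Fin M → Bool, ∑ w : Fin N → Bool,
        if ∃ a b, x ≤ walkPos v a + walkPos w b then (1 : ℝ) else 0 := by
    rw [← sum_bits_not]
    refine Finset.sum_congr rfl fun v _ => ?_
    rw [← sum_bits_not]
    refine Finset.sum_congr rfl fun w _ => ?_
    simp only [walkPos_not]
    congr 1
    simp [add_comm]
  have : (∑ v : Fin M → Bool, ∑ w : Fin N → Bool,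
        if ∃ a b, x ≤ |walkPos v a + walkPos w b| then (1 : ℝ) else 0) ≤
      (∑ v : Fin M → Bool, ∑ w : Fin N → Bool,
        if ∃ a b, x ≤ walkPos v a + walkPos w b then (1 : ℝ) else 0) +
      ∑ v : Fin M → Bool, ∑ w : Fin N → Bool,
        if ∃ a b, x ≤ -(walkPos v a + walkPos w b) then (1 : ℝ) else 0 := by
    simp only [← Finset.sum_add_distrib]
    refine Finset.sum_le_sum fun v _ => Finset.sum_le_sum fun w _ => ?_
    by_cases h0 : ∃ a b, x ≤ |walkPos v a + walkPos w b|
    · rw [if_pos h0]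
      obtain ⟨a, b, hab⟩ := h0
      rcases le_abs.1 hab with h1 | h1
      · rw [if_pos (c := ∃ a b, x ≤ walkPos v a + walkPos w b) ⟨a, b, h1⟩]
        split_ifs <;> norm_num
      · rw [if_pos (c := ∃ a b, x ≤ -(walkPos v a + walkPos w b)) ⟨a, b, h1⟩]
        split_ifs <;> norm_num
    · rw [if_neg h0]
      positivity
  linarith

/-! ### From counting bit patterns to probabilities -/

section Bernoulli

variable {Ω : Type*} [MeasurableSpace Ω] {μ : Measure Ω} {X : ℤ → Ω → ℝ}

open Classical in
lemma IsBernoulliSequence.bitSign_eq {p : ℝ} (hX : IsBernoulliSequence μ p X) (i : ℤ) (ω : Ω) :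
    bitSign (decide (X i ω = 1)) = 2 * X i ω - 1 := by
  rcases hX.mem_bits i ω with h | h <;> simp [bitSign, h]
  norm_num

lemma IsBernoulliSequence.measure_preimage_bit [IsProbabilityMeasure μ]
    (hX : IsBernoulliSequence μ (1 / 2) X)
    (i : ℤ) (b : Bool) : μ (X i ⁻¹' {if b then 1 else 0}) = ENNReal.ofReal (1 / 2) := by
  have h1 : μ.real {ω | X i ω = 1} = 1 / 2 := hX.prob_one i
  cases b with
  | true =>
    rw [← h1, ofReal_measureReal]
    rfl
  | false =>
    have hm : MeasurableSet {ω | X i ω = 1} := hX.measurable i (measurableSet_singleton 1)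
    have h0 : X i ⁻¹' {if false = true then 1 else 0} = {ω | X i ω = 1}ᶜ := by
      ext ω
      rcases hX.mem_bits i ω with h | h <;> simp [h]
    have h2 := probReal_compl_eq_one_sub (μ := μ) hm
    rw [h1] at h2
    rw [h0, ← ofReal_measureReal, h2]
    norm_num

open Classical in
/-- The probability of an event that depends on finitely many bits is at most the proportion of
the bit patterns that satisfy it. -/
lemma IsBernoulliSequence.measure_bits_le [IsProbabilityMeasure μ]
    (hX : IsBernoulliSequence μ (1 / 2) X)
    {ι : Type*} [Fintype ι] [DecidableEq ι] {σ : ι → ℤ} (hσ : σ.Injective) (C : (ι → Bool) → Prop) :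
    μ {ω | C fun i => decide (X (σ i) ω = 1)} ≤
      ENNReal.ofReal ((∑ v, if C v then (1 : ℝ) else 0) * (1 / 2) ^ Fintype.card ι) := by
  have hind := hX.indep.precomp hσ
  have hsub : {ω | C fun i => decide (X (σ i) ω = 1)} ⊆
      ⋃ v ∈ Finset.univ.filter C, ⋂ i ∈ Finset.univ, X (σ i) ⁻¹' {if v i then 1 else 0} := by
    intro ω hω
    simp only [Set.mem_iUnion, Set.mem_iInter, Finset.mem_filter, Finset.mem_univ, true_and]
    refine ⟨_, hω, fun i _ => ?_⟩
    rcases hX.mem_bits (σ i) ω with h | h <;> simp [h]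
  refine (measure_mono hsub).trans ((measure_biUnion_finset_le _ _).trans ?_)
  have hone : ∀ v : ι → Bool,
      μ (⋂ i ∈ Finset.univ, X (σ i) ⁻¹' {if v i then 1 else 0}) =
        ENNReal.ofReal ((1 / 2) ^ Fintype.card ι) := by
    intro v
    rw [hind.measure_inter_preimage_eq_mul Finset.univ
      (sets := fun i => {if v i then 1 else 0}) fun i _ => measurableSet_singleton _]
    simp only [hX.measure_preimage_bit, Finset.prod_const, Finset.card_univ]
    rw [ENNReal.ofReal_pow (by norm_num)]
  rw [Finset.sum_congr rfl fun v _ => hone v, Finset.sum_const, nsmul_eq_mul, Finset.sum_boole,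
    ENNReal.ofReal_mul (by positivity), ENNReal.ofReal_natCast]

end Bernoulli

/-! ### Blocks containing `n` as two-sided sums -/

lemma walkPos_eq_sum_range {M a : ℕ} (ha : a ≤ M) (f : ℕ → Bool) :
    walkPos (fun i : Fin M => f i) a = ∑ i ∈ Finset.range a, bitSign (f i) := by
  rw [walkPos, Fin.sum_univ_eq_sum_range (fun i => if i < a then bitSign (f i) else 0) M,
    ← Finset.sum_filter]
  congr 1
  ext i
  simp only [Finset.mem_filter, Finset.mem_range]
  omega

/-- The centred sum over `a` samples before time `n` and `b` samples from time `n` on. -/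
def twoSidedSum (x : ℤ → ℝ) (n : ℤ) (a b : ℕ) : ℝ :=
  ∑ i ∈ Finset.range a, (2 * x (n - 1 - i) - 1) + ∑ i ∈ Finset.range b, (2 * x (n + i) - 1)

/-- Maximal inequality over all blocks around `n` that reach at most `M` samples to the left
and `N` samples to the right. -/
lemma IsBernoulliSequence.measure_exists_twoSidedSum_le {Ω : Type*} [MeasurableSpace Ω]
    {μ : Measure Ω} [IsProbabilityMeasure μ] {X : ℤ → Ω → ℝ}
    (hX : IsBernoulliSequence μ (1 / 2) X) (n : ℤ) {M N : ℕ} (hMN : 0 < M + N) {x : ℝ}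
    (hx : 0 ≤ x) :
    μ {ω | ∃ a b, a ≤ M ∧ b ≤ N ∧ x ≤ |twoSidedSum (fun i => X i ω) n a b|} ≤
      ENNReal.ofReal (8 * Real.exp (-x ^ 2 / (2 * ((M : ℝ) + N)))) := by
  classical
  let σ : Fin M ⊕ Fin N → ℤ := Sum.elim (fun i => n - 1 - i) (fun i => n + i)
  have hσ : σ.Injective := by
    rintro (i | i) (j | j) h <;> simp only [σ, Sum.elim_inl, Sum.elim_inr] at h
    · congr 1; ext; omega
    · omega
    · omega
    · congr 1; ext; omega
  let C : (Fin M ⊕ Fin N → Bool) → Prop := fun u =>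
    ∃ a b, x ≤ |walkPos (fun i => u (Sum.inl i)) a + walkPos (fun i => u (Sum.inr i)) b|
  have hsub : {ω | ∃ a b, a ≤ M ∧ b ≤ N ∧ x ≤ |twoSidedSum (fun i => X i ω) n a b|} ⊆
      {ω | C fun i => decide (X (σ i) ω = 1)} := by
    rintro ω ⟨a, b, ha, hb, hab⟩
    refine ⟨a, b, ?_⟩
    have e1 := walkPos_eq_sum_range ha (fun i : ℕ => decide (X (n - 1 - i) ω = 1))
    have e2 := walkPos_eq_sum_range hb (fun i : ℕ => decide (X (n + i) ω = 1))
    change x ≤ |walkPos (fun i : Fin M => decide (X (n - 1 - i) ω = 1)) a +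
      walkPos (fun i : Fin N => decide (X (n + i) ω = 1)) b|
    rw [e1, e2]
    simpa only [twoSidedSum, hX.bitSign_eq] using hab
  refine (measure_mono hsub).trans ((hX.measure_bits_le hσ C).trans ?_)
  refine ENNReal.ofReal_le_ofReal ?_
  have hsum : (∑ u, if C u then (1 : ℝ) else 0) = ∑ v : Fin M → Bool, ∑ w : Fin N → Bool,
      if ∃ a b, x ≤ |walkPos v a + walkPos w b| then (1 : ℝ) else 0 := by
    rw [← Fintype.sum_prod_type', ← (Equiv.sumArrowEquivProdArrow (Fin M) (Fin N) Bool).sum_comp]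
    rfl
  rw [hsum, Fintype.card_sum, Fintype.card_fin, Fintype.card_fin]
  refine (mul_le_mul_of_nonneg_right (sum_exists_abs_walkPos_add_le hMN hx)
    (by positivity)).trans (le_of_eq ?_)
  rw [one_div, inv_pow]
  field_simp

/-- An atypical block that contains time `n` has a large two-sided sum around `n`. -/
lemma InAtypicalSubsequence.exists_twoSidedSum {τ : ℝ} {x : ℤ → ℝ} {n : ℤ}
    (h : InAtypicalSubsequence (1 / 2) τ x n) (hτ : 0 ≤ τ) :
    ∃ a b : ℕ, 0 < a + b ∧
      ((a + b : ℕ) : ℝ) * Real.log 4 * (τ + 3 / 2 * Real.logb 2 ((a + b : ℕ) : ℝ)) <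
        twoSidedSum x n a b ^ 2 := by
  obtain ⟨m, l, hm, hl, hat⟩ := h
  obtain ⟨a, rfl⟩ : ∃ a : ℕ, m = n - a := ⟨(n - m).toNat, by omega⟩
  obtain ⟨b, rfl⟩ : ∃ b : ℕ, l = a + b := ⟨l - a, by omega⟩
  have hpos : 0 < a + b := by omega
  refine ⟨a, b, hpos, ?_⟩
  have hlR : (0 : ℝ) < ((a + b : ℕ) : ℝ) := by exact_mod_cast hpos
  have hl1 : (1 : ℝ) ≤ ((a + b : ℕ) : ℝ) := by exact_mod_cast hpos
  have hlog : 0 ≤ Real.logb 2 ((a + b : ℕ) : ℝ) := Real.logb_nonneg (by norm_num) hl1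
  have h4 : 0 < Real.log 4 := Real.log_pos (by norm_num)
  have hsum : twoSidedSum x n a b =
      2 * ∑ i ∈ Finset.range (a + b), x (n - a + (i : ℤ)) - ((a + b : ℕ) : ℝ) := by
    -- The left arm is read backwards from `n - 1`, hence the reflection.
    rw [twoSidedSum, Finset.sum_range_add, ← Finset.sum_range_reflect (fun i => x (n - a + (i : ℤ)))]
    have e1 : ∑ i ∈ Finset.range a, x (n - a + ((a - 1 - i : ℕ) : ℤ)) =
        ∑ i ∈ Finset.range a, x (n - 1 - i) := by
      refine Finset.sum_congr rfl fun i hi => ?_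
      rw [Finset.mem_range] at hi
      congr 1
      omega
    have e2 : ∑ i ∈ Finset.range b, x (n - a + ((a + i : ℕ) : ℤ)) =
        ∑ i ∈ Finset.range b, x (n + i) := by
      refine Finset.sum_congr rfl fun i _ => ?_
      congr 1
      push_cast
      ring
    rw [e1, e2]
    simp only [Finset.sum_sub_distrib, ← Finset.mul_sum, Finset.sum_const, Finset.card_range,
      nsmul_eq_mul]
    push_cast
    ring
  unfold IsAtypicalBlock atypThreshold blockMean at hat
  set l : ℝ := ((a + b : ℕ) : ℝ) with hl_def
  set S := ∑ i ∈ Finset.range (a + b), x (n - a + (i : ℤ)) with hS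
  have hmean : S / l - 1 / 2 = twoSidedSum x n a b / (2 * l) := by
    rw [hsum]
    field_simp
  rw [hmean] at hat
  -- Here `p (1 - p) = 1/4` cancels the factor 4 of `(2 l)²`.
  have hsq := pow_lt_pow_left₀ hat (by positivity) two_ne_zero
  rw [sq_abs, mul_pow, Real.sq_sqrt (by positivity), Real.sq_sqrt (by positivity), div_pow,
    lt_div_iff₀ (by positivity)] at hsq
  refine lt_of_eq_of_lt ?_ hsq
  field_simp
  ring

lemma abs_twoSidedSum_le {x : ℤ → ℝ} (hx : ∀ i, x i = 0 ∨ x i = 1) (n : ℤ) (a b : ℕ) :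
    |twoSidedSum x n a b| ≤ ((a + b : ℕ) : ℝ) := by
  have h1 : ∀ i, |2 * x i - 1| ≤ 1 := fun i => by
    rcases hx i with h | h <;> rw [h] <;> norm_num
  rw [twoSidedSum]
  refine (abs_add_le _ _).trans ?_
  push_cast
  gcongr
  · refine (Finset.abs_sum_le_sum_abs _ _).trans ?_
    simpa using Finset.sum_le_sum fun i (_ : i ∈ Finset.range a) => h1 (n - 1 - i)
  · refine (Finset.abs_sum_le_sum_abs _ _).trans ?_
    simpa using Finset.sum_le_sum fun i (_ : i ∈ Finset.range b) => h1 (n + i)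

/-! ### Dyadic scales and their cells -/

/-- The two-sided sum around `n` exceeds the threshold for blocks of `a + b` samples. -/
def ExceedsThreshold (τ : ℝ) (x : ℤ → ℝ) (n : ℤ) (a b : ℕ) : Prop :=
  ((a + b : ℕ) : ℝ) * Real.log 4 * (τ + 3 / 2 * Real.logb 2 ((a + b : ℕ) : ℝ)) <
    twoSidedSum x n a b ^ 2

lemma log_four_eq : Real.log 4 = 2 * Real.log 2 := by
  rw [show (4 : ℝ) = 2 ^ 2 by norm_num, Real.log_pow]
  norm_num

/-- The sum is at most `l` in absolute value, whereas `ln 4 ≥ 1` makes the squared threshold at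
least `l τ`. -/
lemma ExceedsThreshold.lt_length {τ : ℝ} {x : ℤ → ℝ} {n : ℤ} {a b : ℕ}
    (h : ExceedsThreshold τ x n a b) (hx : ∀ i, x i = 0 ∨ x i = 1)
    (hab : 0 < a + b) : τ < ((a + b : ℕ) : ℝ) := by
  have h1 := abs_twoSidedSum_le hx n a b
  have h2 : twoSidedSum x n a b ^ 2 ≤ ((a + b : ℕ) : ℝ) ^ 2 := by
    rw [← sq_abs]
    gcongr
  unfold ExceedsThreshold at h
  have hl1 : (1 : ℝ) ≤ ((a + b : ℕ) : ℝ) := by exact_mod_cast hab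
  have hlog : 0 ≤ Real.logb 2 ((a + b : ℕ) : ℝ) := Real.logb_nonneg (by norm_num) hl1
  set l : ℝ := ((a + b : ℕ) : ℝ)
  have h4 : 1 ≤ Real.log 4 := by
    rw [log_four_eq]
    linarith [Real.log_two_gt_d9]
  by_contra! hle
  have h5 : l * 1 * (l + 3 / 2 * 0) ≤ l * Real.log 4 * (τ + 3 / 2 * Real.logb 2 l) := by
    gcongr
  nlinarith

section Bernoulli

variable {Ω : Type*} [MeasurableSpace Ω] {μ : Measure Ω} [IsProbabilityMeasure μ] {X : ℤ → Ω → ℝ}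

/-- The maximal inequality over a cell of blocks whose two arm lengths vary by at most `D`. -/
lemma IsBernoulliSequence.measure_cell_le (hX : IsBernoulliSequence μ (1 / 2) X) (n : ℤ)
    {τ : ℝ} (hτ : 0 ≤ τ) (k A B D : ℕ) (hD : (D : ℝ) * (τ + k + 1) ≤ 2 ^ k) :
    μ {ω | ∃ a b, (A ≤ a ∧ a ≤ A + D) ∧ (B ≤ b ∧ b ≤ B + D) ∧ 2 ^ k ≤ a + b ∧
        ExceedsThreshold τ (fun i => X i ω) n a b} ≤
      ENNReal.ofReal (64 * (2 : ℝ) ^ (-(τ + 3 / 2 * k))) := by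
  rcases Nat.eq_zero_or_pos ((A + D) + (B + D)) with h0 | hMN
  · refine le_of_eq_of_le ?_ (zero_le)
    convert measure_empty (μ := μ)
    rw [Set.eq_empty_iff_forall_notMem]
    rintro ω ⟨a, b, ⟨-, ha⟩, ⟨-, hb⟩, hk, -⟩
    have : 0 < 2 ^ k := by positivity
    omega
  -- `L` bounds from below the length of every block considered in the cell; `K` below is the full
  -- reach of the cell.
  set L : ℕ := max (A + B) (2 ^ k) with hL
  set T : ℝ := τ + 3 / 2 * k with hT
  have hT0 : 0 ≤ T := by positivity
  have hLk : (2 : ℝ) ^ k ≤ L := by exact_mod_cast le_max_right _ _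
  have hLpos : (0 : ℝ) < L := lt_of_lt_of_le (by positivity) hLk
  have h2 : 0 < Real.log 2 := Real.log_pos (by norm_num)
  have hx2 : 0 ≤ L * Real.log 4 * T := by
    rw [log_four_eq]
    positivity
  have key := hX.measure_exists_twoSidedSum_le n hMN (Real.sqrt_nonneg (L * Real.log 4 * T))
  refine (measure_mono ?_).trans (key.trans (ENNReal.ofReal_le_ofReal ?_))
  · rintro ω ⟨a, b, ⟨ha, ha'⟩, ⟨hb, hb'⟩, hk, hex⟩
    refine ⟨a, b, ha', hb', Real.sqrt_le_iff.2 ⟨abs_nonneg _, ?_⟩⟩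
    rw [sq_abs]
    refine le_trans ?_ (le_of_lt hex)
    have hLl : L ≤ a + b := by omega
    have hlog : (k : ℝ) ≤ Real.logb 2 ((a + b : ℕ) : ℝ) := by
      have hk' : (2 : ℝ) ^ k ≤ ((a + b : ℕ) : ℝ) := by exact_mod_cast hk
      rw [Real.le_logb_iff_rpow_le (by norm_num) (lt_of_lt_of_le (by positivity) hk'),
        Real.rpow_natCast]
      exact hk'
    have h4 : 0 ≤ Real.log 4 := Real.log_nonneg (by norm_num)
    have hLl' : (L : ℝ) ≤ ((a + b : ℕ) : ℝ) := by exact_mod_cast hLl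
    rw [hT]
    gcongr
  · rw [Real.sq_sqrt hx2, log_four_eq]
    push_cast
    set K : ℝ := (A : ℝ) + D + (B + D) with hK
    have hKpos : 0 < K := by rw [hK]; exact_mod_cast hMN
    have hKL : K ≤ L + 2 * D := by
      have : ((A + B : ℕ) : ℝ) ≤ L := by exact_mod_cast le_max_left _ _
      push_cast at this
      rw [hK]
      linarith
    have hDT : (D : ℝ) * T ≤ 3 / 2 * L := by
      have : (D : ℝ) * T ≤ D * (3 / 2 * (τ + k + 1)) := by
        gcongr
        rw [hT]
        linarith
      nlinarith
    -- Since `K ≤ L + 2 D` and `2 D T ≤ 3 L`, using the reach `K` in place of `L` costs at most 3 in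
    -- the exponent. This factor `2^3`, with the 8 of the maximal inequality, gives 64.
    have hmain : (T - 3) * K ≤ T * L := by
      rcases le_or_gt T 3 with h3 | h3
      · exact (mul_nonpos_of_nonpos_of_nonneg (by linarith) hKpos.le).trans (by positivity)
      · have := mul_le_mul_of_nonneg_left hKL (sub_nonneg.2 h3.le)
        have hD0 : (0 : ℝ) ≤ D := by positivity
        nlinarith
    have hexp : -(L * (2 * Real.log 2) * T) / (2 * K) ≤ Real.log 2 * (3 + -T) := by
      rw [div_le_iff₀ (by positivity)]
      nlinarith [mul_le_mul_of_nonneg_left hmain h2.le]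
    have h8 : Real.exp (Real.log 2 * (3 + -T)) = 8 * (2 : ℝ) ^ (-T) := by
      rw [← Real.rpow_def_of_pos (by norm_num), Real.rpow_add (by norm_num)]
      norm_num
    have := Real.exp_le_exp.2 hexp
    rw [h8] at this
    linarith

/-- The probability that a block around `n` of length in `[2 ^ k, 2 ^ (k + 1))` is atypical. -/
lemma IsBernoulliSequence.measure_dyadic_le (hX : IsBernoulliSequence μ (1 / 2) X) (n : ℤ)
    {τ : ℝ} (hτ : 0 ≤ τ) (k : ℕ) :
    μ {ω | ∃ a b, 2 ^ k ≤ a + b ∧ a + b < 2 ^ (k + 1) ∧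
        ExceedsThreshold τ (fun i => X i ω) n a b} ≤
      ENNReal.ofReal ((2 * τ + 2 * k + 3) ^ 2 * (64 * (2 : ℝ) ^ (-(τ + 3 / 2 * k)))) := by
  have hs : 0 < τ + k + 1 := by positivity
  set D : ℕ := ⌊(2 : ℝ) ^ k / (τ + k + 1)⌋₊ with hDdef
  have hD : (D : ℝ) * (τ + k + 1) ≤ 2 ^ k := by
    rw [← le_div_iff₀ hs]
    exact Nat.floor_le (by positivity)
  have hD' : (2 : ℝ) ^ k < ((D : ℝ) + 1) * (τ + k + 1) := by
    rw [← div_lt_iff₀ hs]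
    exact Nat.lt_floor_add_one _
  -- A cell has `D + 1` values per arm, more than `2^k / (τ + k + 1)` even when the floor `D` is 0,
  -- so `R` cells per arm cover all lengths below `2^(k + 1)`.
  set R : ℕ := ⌈2 * (τ + k + 1)⌉₊ with hR
  have hRle : (R : ℝ) ≤ 2 * τ + 2 * k + 3 := by
    have := (Nat.ceil_lt_add_one (show 0 ≤ 2 * (τ + k + 1) by positivity)).le
    linarith
  have hidx : ∀ a : ℕ, a < 2 ^ (k + 1) → a / (D + 1) < R := by
    intro a ha
    rw [hR, Nat.lt_ceil]
    have h1 : ((a / (D + 1) : ℕ) : ℝ) * ((D : ℝ) + 1) ≤ a := by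
      exact_mod_cast Nat.div_mul_le_self a (D + 1)
    have h2 : (a : ℝ) < 2 ^ (k + 1) := by exact_mod_cast ha
    have h3 : (0 : ℝ) < (D : ℝ) + 1 := by positivity
    rw [pow_succ] at h2
    refine lt_of_mul_lt_mul_right (a := (D : ℝ) + 1) ?_ h3.le
    nlinarith
  let cell : ℕ × ℕ → Set Ω := fun pq =>
    {ω | ∃ a b, (pq.1 * (D + 1) ≤ a ∧ a ≤ pq.1 * (D + 1) + D) ∧
      (pq.2 * (D + 1) ≤ b ∧ b ≤ pq.2 * (D + 1) + D) ∧ 2 ^ k ≤ a + b ∧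
      ExceedsThreshold τ (fun i => X i ω) n a b}
  have hsub : {ω | ∃ a b, 2 ^ k ≤ a + b ∧ a + b < 2 ^ (k + 1) ∧
      ExceedsThreshold τ (fun i => X i ω) n a b} ⊆
      ⋃ pq ∈ Finset.range R ×ˢ Finset.range R, cell pq := by
    rintro ω ⟨a, b, hk, hk', hex⟩
    simp only [Set.mem_iUnion]
    have hbnd : ∀ a : ℕ, a / (D + 1) * (D + 1) ≤ a ∧ a ≤ a / (D + 1) * (D + 1) + D := by
      intro a
      have h1 := Nat.div_add_mod' a (D + 1)
      have h2 := Nat.mod_lt a (Nat.succ_pos D)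
      rw [Nat.succ_eq_add_one] at h2
      constructor <;> omega
    refine ⟨(a / (D + 1), b / (D + 1)), ?_, a, b, hbnd a, hbnd b, hk, hex⟩
    simp only [Finset.mem_product, Finset.mem_range]
    exact ⟨hidx a (by omega), hidx b (by omega)⟩
  refine (measure_mono hsub).trans ((measure_biUnion_finset_le _ _).trans ?_)
  refine (Finset.sum_le_sum fun pq _ =>
    hX.measure_cell_le n hτ k (pq.1 * (D + 1)) (pq.2 * (D + 1)) D hD).trans ?_
  rw [Finset.sum_const, Finset.card_product, Finset.card_range, nsmul_eq_mul,
    ← ENNReal.ofReal_natCast, ← ENNReal.ofReal_mul (by positivity)]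
  refine ENNReal.ofReal_le_ofReal ?_
  push_cast
  rw [← sq]
  gcongr

end Bernoulli

/-! ### Summation over the scales -/

lemma sq_mul_two_rpow_le (k : ℕ) :
    (2 * (k : ℝ) + 3) ^ 2 * (2 : ℝ) ^ (-(3 / 2 * (k : ℝ))) ≤ 144 * (1 / 2) ^ k := by
  set s : ℝ := (2 : ℝ) ^ (1 / 4 : ℝ) with hs
  have hs0 : 0 < s := by positivity
  have hs4 : s ^ 4 = 2 := by
    rw [hs, ← Real.rpow_natCast, ← Real.rpow_mul (by norm_num)]
    norm_num
  -- As `(7/6)^4 < 2`, Bernoulli's inequality gives `12 s^k ≥ 12 + 2 k`; then `s^(2k)` absorbs the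
  -- polynomial and leaves `s^(-4k) = 2^(-k)`.
  have hs1 : 7 / 6 ≤ s := by
    by_contra! h
    have := pow_lt_pow_left₀ h hs0.le (show 4 ≠ 0 by norm_num)
    rw [hs4] at this
    norm_num at this
  have hsk : 1 + (k : ℝ) * (s - 1) ≤ s ^ k := by
    simpa using one_add_mul_le_pow (show (-2 : ℝ) ≤ s - 1 by linarith) k
  have hlin : 2 * (k : ℝ) + 3 ≤ 12 * s ^ k := by
    have hk0 : (0 : ℝ) ≤ k := by positivity
    nlinarith
  have hE : (2 : ℝ) ^ (-(3 / 2 * (k : ℝ))) = ((s ^ k) ^ 6)⁻¹ := by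
    rw [Real.rpow_neg (by norm_num), ← pow_mul, hs, ← Real.rpow_natCast,
      ← Real.rpow_mul (by norm_num)]
    congr 2
    push_cast
    ring
  have hH : ((1 : ℝ) / 2) ^ k = ((s ^ k) ^ 4)⁻¹ := by
    rw [← pow_mul, mul_comm k 4, pow_mul, hs4, one_div, inv_pow]
  rw [hE, hH]
  have hpos : 0 < s ^ k := by positivity
  have hsq : (2 * (k : ℝ) + 3) ^ 2 ≤ (12 * s ^ k) ^ 2 := by gcongr
  calc _ ≤ (12 * s ^ k) ^ 2 * ((s ^ k) ^ 6)⁻¹ := by gcongr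
    _ = _ := by
      field_simp
      norm_num

/-- Of `τ² = √τ · τ^(3/2)`, the second factor is absorbed by the decay at the starting scale `k₀`,
up to `2^(3/2) ≤ 4`. -/
lemma sq_mul_two_rpow_le_sqrt {τ : ℝ} (hτ : 0 ≤ τ) {k₀ : ℕ} (hk : τ ≤ 2 ^ (k₀ + 1)) (j : ℕ) :
    τ ^ 2 * (2 : ℝ) ^ (-(3 / 2 * ((k₀ + j : ℕ) : ℝ))) ≤ 4 * Real.sqrt τ * (1 / 2) ^ j := by
  have h1 : τ ^ 2 = Real.sqrt τ * τ ^ (3 / 2 : ℝ) := by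
    rw [Real.sqrt_eq_rpow, ← Real.rpow_natCast, ← Real.rpow_add_of_nonneg hτ (by norm_num)
      (by norm_num)]
    norm_num
  have h2 : τ ^ (3 / 2 : ℝ) ≤ (2 : ℝ) ^ (3 / 2 * ((k₀ : ℝ) + 1)) := by
    calc τ ^ (3 / 2 : ℝ) ≤ ((2 : ℝ) ^ (k₀ + 1)) ^ (3 / 2 : ℝ) := by gcongr
      _ = _ := by
        rw [← Real.rpow_natCast, ← Real.rpow_mul (by norm_num)]
        congr 1
        push_cast
        ring
  have h3 : (2 : ℝ) ^ (3 / 2 * ((k₀ : ℝ) + 1)) * (2 : ℝ) ^ (-(3 / 2 * ((k₀ + j : ℕ) : ℝ))) ≤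
      4 * (1 / 2) ^ j := by
    rw [← Real.rpow_add (by norm_num)]
    have h4 : (4 : ℝ) * (1 / 2) ^ j = (2 : ℝ) ^ (2 - (j : ℝ)) := by
      rw [Real.rpow_sub (by norm_num), Real.rpow_natCast, one_div, inv_pow]
      norm_num
      rfl
    rw [h4]
    refine Real.rpow_le_rpow_of_exponent_le (by norm_num) ?_
    have : (0 : ℝ) ≤ j := by positivity
    push_cast
    linarith
  rw [h1]
  calc _ ≤ Real.sqrt τ * (2 : ℝ) ^ (3 / 2 * ((k₀ : ℝ) + 1)) *
          (2 : ℝ) ^ (-(3 / 2 * ((k₀ + j : ℕ) : ℝ))) := by gcongr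
    _ = Real.sqrt τ * ((2 : ℝ) ^ (3 / 2 * ((k₀ : ℝ) + 1)) *
          (2 : ℝ) ^ (-(3 / 2 * ((k₀ + j : ℕ) : ℝ)))) := by ring
    _ ≤ Real.sqrt τ * (4 * (1 / 2) ^ j) := by gcongr
    _ = _ := by ring

lemma dyadic_bound_le {τ : ℝ} (hτ : 0 ≤ τ) {k₀ : ℕ} (hk : τ ≤ 2 ^ (k₀ + 1)) (j : ℕ) :
    (2 * τ + 2 * ((k₀ + j : ℕ) : ℝ) + 3) ^ 2 *
        (64 * (2 : ℝ) ^ (-(τ + 3 / 2 * ((k₀ + j : ℕ) : ℝ)))) ≤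
      (2048 * Real.sqrt τ + 18432) * (2 : ℝ) ^ (-τ) * (1 / 2) ^ j := by
  have h1 := sq_mul_two_rpow_le (k₀ + j)
  have h2 := sq_mul_two_rpow_le_sqrt hτ hk j
  have h3 : ((1 : ℝ) / 2) ^ (k₀ + j) ≤ (1 / 2) ^ j :=
    pow_le_pow_of_le_one (by norm_num) (by norm_num) (by omega)
  set k : ℝ := ((k₀ + j : ℕ) : ℝ)
  have h4 : (2 * τ + 2 * k + 3) ^ 2 ≤ 8 * τ ^ 2 + 2 * (2 * k + 3) ^ 2 := by
    nlinarith [sq_nonneg (2 * τ - (2 * k + 3))]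
  rw [neg_add, Real.rpow_add (by norm_num)]
  have hE : (0 : ℝ) < (2 : ℝ) ^ (-(3 / 2 * k)) := by positivity
  have hF : (0 : ℝ) < (2 : ℝ) ^ (-τ) := by positivity
  set E : ℝ := (2 : ℝ) ^ (-(3 / 2 * k))
  set F : ℝ := (2 : ℝ) ^ (-τ)
  have h5 : (2 * τ + 2 * k + 3) ^ 2 * E ≤ (32 * Real.sqrt τ + 288) * (1 / 2) ^ j := by
    have := mul_le_mul_of_nonneg_right h4 hE.le
    linarith
  have := mul_le_mul_of_nonneg_right h5 hF.le
  linarith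

theorem IsBernoulliSequence.atypSampleProb_le {Ω : Type*} [MeasurableSpace Ω]
    {μ : Measure Ω} [IsProbabilityMeasure μ] {X : ℤ → Ω → ℝ}
    (hX : IsBernoulliSequence μ (1 / 2) X) (n : ℤ) {τ : ℝ} (hτ : 0 ≤ τ) :
    atypSampleProb μ (1 / 2) τ X n ≤ (4096 * Real.sqrt τ + 36864) * (2 : ℝ) ^ (-τ) := by
  -- For `τ < 1` the default `Nat.log 2 0 = 0` is harmless: `τ ≤ 2^(k₀ + 1)` still holds.
  set k₀ : ℕ := Nat.log 2 ⌊τ⌋₊ with hk₀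
  have hk : τ ≤ 2 ^ (k₀ + 1) := by
    have h1 : ⌊τ⌋₊ + 1 ≤ 2 ^ (k₀ + 1) := Nat.lt_pow_succ_log_self (by norm_num) _
    have h2 : ((⌊τ⌋₊ : ℝ) + 1) ≤ 2 ^ (k₀ + 1) := by exact_mod_cast h1
    exact (Nat.lt_floor_add_one τ).le.trans h2
  have hsub : {ω | InAtypicalSubsequence (1 / 2) τ (fun i => X i ω) n} ⊆
      ⋃ j : ℕ, {ω | ∃ a b, 2 ^ (k₀ + j) ≤ a + b ∧ a + b < 2 ^ (k₀ + j + 1) ∧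
        ExceedsThreshold τ (fun i => X i ω) n a b} := by
    intro ω hω
    obtain ⟨a, b, hab, hex⟩ := InAtypicalSubsequence.exists_twoSidedSum hω hτ
    have hlt := ExceedsThreshold.lt_length hex (fun i => hX.mem_bits i ω) hab
    have hlog : k₀ ≤ Nat.log 2 (a + b) :=
      Nat.log_mono_right (Nat.floor_le_of_le hlt.le)
    obtain ⟨j, hj⟩ := Nat.exists_eq_add_of_le hlog
    refine Set.mem_iUnion.2 ⟨j, a, b, ?_, ?_, hex⟩
    · rw [← hj]
      exact Nat.pow_log_le_self 2 hab.ne'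
    · rw [← hj]
      exact Nat.lt_pow_succ_log_self (by norm_num) _
  set c : ℝ := (2048 * Real.sqrt τ + 18432) * (2 : ℝ) ^ (-τ) with hc
  have hc0 : 0 ≤ c := by positivity
  have hle : μ {ω | InAtypicalSubsequence (1 / 2) τ (fun i => X i ω) n} ≤
      ENNReal.ofReal (c * 2) := by
    refine (measure_mono hsub).trans ((measure_iUnion_le _).trans ?_)
    refine (ENNReal.tsum_le_tsum fun j => (hX.measure_dyadic_le n hτ (k₀ + j)).trans
      (ENNReal.ofReal_le_ofReal (dyadic_bound_le hτ hk j))).trans ?_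
    rw [← ENNReal.ofReal_tsum_of_nonneg (fun j => by positivity)
      (summable_geometric_two.mul_left c), tsum_mul_left, tsum_geometric_two]
  have hreal : atypSampleProb μ (1 / 2) τ X n ≤ c * 2 :=
    ENNReal.toReal_le_of_le_ofReal (by positivity) hle
  refine hreal.trans (le_of_eq ?_)
  rw [hc]
  ring

/-! ### Decay for large `τ` -/

lemma tendsto_sqrt_mul_two_rpow_neg (K₁ K₂ : ℝ) :
    Filter.Tendsto (fun τ : ℝ => (K₁ * Real.sqrt τ + K₂) * (2 : ℝ) ^ (-τ)) Filter.atTop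
      (nhds 0) := by
  have h2 : 0 < Real.log 2 := Real.log_pos (by norm_num)
  have h1 := (tendsto_rpow_mul_exp_neg_mul_atTop_nhds_zero (1 / 2) _ h2).const_mul K₁
  have h0 := (tendsto_rpow_mul_exp_neg_mul_atTop_nhds_zero 0 _ h2).const_mul K₂
  have := h1.add h0
  simp only [mul_zero, add_zero] at this
  refine this.congr fun τ => ?_
  rw [Real.rpow_def_of_pos (x := 2) (by norm_num), Real.sqrt_eq_rpow, Real.rpow_zero, mul_neg,
    neg_mul]
  ring

lemma IsBernoulliSequence.exists_forall_atypSampleProb_lt {ε : ℝ} (hε : 0 < ε) :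
    ∃ τ₀ : ℝ, ∀ (Ω : Type u) [MeasurableSpace Ω] (μ : Measure Ω)
        [IsProbabilityMeasure μ] (X : ℤ → Ω → ℝ), IsBernoulliSequence μ (1 / 2) X →
        ∀ (n : ℤ) (τ : ℝ), τ₀ ≤ τ → atypSampleProb μ (1 / 2) τ X n < ε := by
  have h := ((tendsto_sqrt_mul_two_rpow_neg 4096 36864).eventually_lt_const hε).and
    (Filter.eventually_ge_atTop 0)
  obtain ⟨τ₀, hτ₀⟩ := Filter.eventually_atTop.1 h
  exact ⟨τ₀, fun Ω _ μ _ X hX n τ hτ =>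
    (hX.atypSampleProb_le n (hτ₀ τ hτ).2).trans_lt (hτ₀ τ hτ).1⟩

theorem theorem3 :
    (∃ K₁ K₂ : ℝ, ∀ (Ω : Type u) [MeasurableSpace Ω] (μ : Measure Ω) [IsProbabilityMeasure μ]
        (X : ℤ → Ω → ℝ), IsBernoulliSequence μ (1 / 2) X →
        ∀ (n : ℤ) (τ : ℝ), 0 ≤ τ →
          atypSampleProb μ (1 / 2) τ X n ≤ (K₁ * Real.sqrt τ + K₂) * (2 : ℝ) ^ (-τ)) ∧
    (∃ τ₀ : ℝ, ∀ (Ω : Type u) [MeasurableSpace Ω] (μ : Measure Ω) [IsProbabilityMeasure μ]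
        (X : ℤ → Ω → ℝ), IsBernoulliSequence μ (1 / 2) X →
        ∀ (n : ℤ) (τ : ℝ), τ₀ ≤ τ → atypSampleProb μ (1 / 2) τ X n < 1) ∧
    (∀ ε : ℝ, 0 < ε → ∃ τ₀ : ℝ, ∀ (Ω : Type u) [MeasurableSpace Ω] (μ : Measure Ω)
        [IsProbabilityMeasure μ] (X : ℤ → Ω → ℝ), IsBernoulliSequence μ (1 / 2) X →
        ∀ (n : ℤ) (τ : ℝ), τ₀ ≤ τ → atypSampleProb μ (1 / 2) τ X n < ε) :=
  ⟨⟨4096, 36864, fun _ _ _ _ _ hX n _ hτ => hX.atypSampleProb_le n hτ⟩,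
    IsBernoulliSequence.exists_forall_atypSampleProb_lt one_pos,
    fun _ hε => IsBernoulliSequence.exists_forall_atypSampleProb_lt hε⟩
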